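/- Let $\mu,\lambda,c>0$ and $\pi\in[0,1)$. Let $N=\{N_t\}_{t\ge 0}$ be a homogeneous Poisson process with rate $\mu$ on a probability space $(\Omega,\mathcal H,\mathbb P_0)$. Let $\theta\ge 0$ and $\Lambda$ be random variables on this space such that $\theta$ and $\Lambda$ are independent and $(\theta,\Lambda)$ is independent of $N$, where $\Lambda\ge 0$ almost surely and $\Lambda$ has finite moments of all orders, and $$\mathbb P_0\{\theta=0\}=\pi,\qquad \mathbb P_0\{\theta>t\}=(1-\pi)e^{-\lambda t},\quad t\ge 0 .$$ Let $\mathcal N\subseteq\mathcal H$ be a family of $\mathbb P_0$-null events, and let $\mathbb F=\{\mathcal F_t\}_{t\ge0}$, $\mathcal F_t=\bigcap_{s>t}\big(\sigma(N_u;\,0\le u\le s)\vee\sigma(\mathcal N)\big)$, be the right-continuous enlargement with $\mathcal N$ of the natural filtration of $N$. Put $\mathcal G_t=\mathcal F_t\vee\sigma(\theta,\Lambda)$, $h(t)=\mu 1_{\{t<\theta\}}+\Lambda 1_{\{t\ge\theta\}}$ and $$Z_t=\exp\Big\{\int_{(0,t]}\log\Big(\frac{h(s-)}{\mu}\Big)\,dN_s-\int_0^t\big(h(s)-\mu\big)\,ds\Big\},\qquad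 t\ge 0,$$ with $\log 0=-\infty$ and $e^{-\infty}=0$. Let $\mathbb P$ be a probability measure on $(\Omega,\mathcal H)$ such that $\frac{d\mathbb P}{d\mathbb P_0}\big|_{\mathcal G_t}=Z_t$ for every $t\ge 0$ (so that, under $\mathbb P$, $N$ is a Poisson process whose rate changes from $\mu$ to $\Lambda$ at the time $\theta$). Let $\mathbb E_0,\mathbb E$ denote the expectations under $\mathbb P_0,\mathbb P$. Let $\Phi^{(0)}=\{\Phi^{(0)}_t\}_{t\ge 0}$ be an $\mathbb F$-adapted process, jointly measurable in $(t,\omega)$, such that for every $t\ge0$ $$\Phi^{(0)}_t=\frac{\mathbb P\{\theta\le t\mid\mathcal F_t\}}{1-\mathbb P\{\theta\le t\mid\mathcal F_t\}}\qquad \mathbb P\text{-a.s.}$$ Then, for every $\mathbb F$-stopping time $\tau$ with values in $[0,\infty]$, the Bayes risk satisfies $$\mathbb P\{\tau<\theta\}+c\,\mathbb E\big[(\tau-\theta)^+\big]=1-\pi+c(1-\pi)\,\mathbb E_0\Big[\int_0^\tau e^{-\lambda t}\Big(\Phi^{(0)}_t-\frac{\lambda}{c}\Big)dt\Big].$$ Here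 both sides are well defined in $(-\infty,\infty]$, and they may be $+\infty$. -/

import Mathlib

open MeasureTheory ProbabilityTheory Set
open scoped NNReal ENNReal

noncomputable section

namespace PoissonDisorder

/-- The extended integral `∫ f⁺ - ∫ f⁻` of an extended-real function, with values in `[-∞, ∞]`.
The indeterminate case `∞ - ∞` has the value `⊥` by the conventions of `EReal`. -/
def extIntegral {α : Type*} [MeasurableSpace α] (m : Measure α) (f : α → EReal) : EReal :=
  ((∫⁻ x, (f x).toENNReal ∂m : ℝ≥0∞) : EReal) - ((∫⁻ x, (-f x).toENNReal ∂m : ℝ≥0∞) : EReal)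

variable {Ω : Type*} [mΩ : MeasurableSpace Ω]

/-- `N` is a homogeneous Poisson process with rate `μ` under `P₀`. -/
structure IsPoissonProcess (P₀ : Measure Ω) (μ : ℝ≥0) (N : ℝ≥0 → Ω → ℕ) : Prop where
  measurable : ∀ t, Measurable (N t)
  zero : ∀ᵐ ω ∂P₀, N 0 ω = 0
  mono : ∀ᵐ ω ∂P₀, Monotone fun t ↦ N t ω
  right_continuous : ∀ᵐ ω ∂P₀, ∀ t, ContinuousWithinAt (fun s ↦ N s ω) (Ici t) t
  indep_increments : HasIndepIncrements N P₀
  law_increments : ∀ s t, s ≤ t → HasLaw (fun ω ↦ N t ω - N s ω) (poissonMeasure (μ * (t - s))) P₀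

/-- The observation filtration `𝓕`: the right-continuous enlargement, by the family `𝓝` of null
events, of the natural filtration, that is, `𝓕_t = ⋂_{s > t} (σ(N_u : u ≤ s) ∨ σ(𝓝))`. -/
def obsFiltration (N : ℝ≥0 → Ω → ℕ) (hN : ∀ t, Measurable (N t))
    (𝓝 : Set (Set Ω)) (h𝓝 : ∀ A ∈ 𝓝, MeasurableSet A) : Filtration ℝ≥0 mΩ :=
  (Filtration.natural N (fun t ↦ (hN t).stronglyMeasurable) ⊔
    Filtration.const ℝ≥0 (MeasurableSpace.generateFrom 𝓝)
      (MeasurableSpace.generateFrom_le h𝓝)).rightCont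

/-- `𝓖_t = 𝓕_t ∨ σ(θ, Λ)`. -/
abbrev enlarged (𝓕 : Filtration ℝ≥0 mΩ) (θ : Ω → ℝ≥0) (Λ : Ω → ℝ) (t : ℝ≥0) : MeasurableSpace Ω :=
  𝓕 t ⊔ MeasurableSpace.comap θ inferInstance ⊔ MeasurableSpace.comap Λ inferInstance

/-- The intensity `h(t) = μ 1_{t < θ} + Λ 1_{t ≥ θ}`. -/
def intensity (μ : ℝ≥0) (θ : Ω → ℝ≥0) (Λ : Ω → ℝ) (t : ℝ≥0) (ω : Ω) : ℝ :=
  if t < θ ω then (μ : ℝ) else Λ ω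

/-- The jump `N_s - N_{s-}`. -/
def jump (N : ℝ≥0 → Ω → ℕ) (s : ℝ≥0) (ω : Ω) : ℕ :=
  N s ω - Function.leftLim (fun u ↦ N u ω) s

/-- The pathwise integral `∫_{(0,t]} log (h(s-)/μ) dN_s`, a finite sum over the jump times of `N`,
with `log 0 = -∞`. -/
def logIntegral (N : ℝ≥0 → Ω → ℕ) (μ : ℝ≥0) (θ : Ω → ℝ≥0) (Λ : Ω → ℝ) (t : ℝ≥0) (ω : Ω) :
    EReal :=
  ∑ᶠ s ∈ {s : ℝ≥0 | s ∈ Ioc 0 t ∧ jump N s ω ≠ 0},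
    jump N s ω •
      ENNReal.log (ENNReal.ofReal (Function.leftLim (fun u ↦ intensity μ θ Λ u ω) s / μ))

/-- `Z_t = exp (∫_0^t log (h(s-)/μ) dN_s - ∫_0^t (h(s) - μ) ds)`. -/
def density (N : ℝ≥0 → Ω → ℕ) (μ : ℝ≥0) (θ : Ω → ℝ≥0) (Λ : Ω → ℝ) (t : ℝ≥0) (ω : Ω) : ℝ≥0∞ :=
  EReal.exp (logIntegral N μ θ Λ t ω -
    ((∫ s in (0 : ℝ)..t, (intensity μ θ Λ s.toNNReal ω - μ) : ℝ) : EReal))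

/-- The Bayes risk `P{τ < θ} + c E(τ - θ)⁺`; subtraction in `[0, ∞]` is truncated at zero. -/
def bayesRisk (P : Measure Ω) (θ : Ω → ℝ≥0) (c : ℝ) (τ : Ω → ℝ≥0∞) : ℝ≥0∞ :=
  P {ω | τ ω < θ ω} + ENNReal.ofReal c * ∫⁻ ω, (τ ω - θ ω) ∂P

/-- `E[(Λ - μ)^k 1_{θ ≤ t} | 𝓕_t] / (1 - P(θ ≤ t | 𝓕_t))`, up to a null set for each `t`. -/
def oddsRatio (P : Measure Ω) (𝓕 : Filtration ℝ≥0 mΩ) (μ : ℝ≥0) (θ : Ω → ℝ≥0) (Λ : Ω → ℝ)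
    (k : ℕ) (t : ℝ≥0) (ω : Ω) : ℝ :=
  (P[{ω' | θ ω' ≤ t}.indicator (fun ω' ↦ (Λ ω' - μ) ^ k) | 𝓕 t]) ω /
    (1 - (P[{ω' | θ ω' ≤ t}.indicator (fun _ ↦ (1 : ℝ)) | 𝓕 t]) ω)

/-- `Φ` is a version of the process `Φ^{(k)}` that is adapted to `𝓕` and jointly measurable in
time and `ω`. -/
structure IsOddsRatioProcess (P : Measure Ω) (𝓕 : Filtration ℝ≥0 mΩ) (μ : ℝ≥0) (θ : Ω → ℝ≥0)
    (Λ : Ω → ℝ) (k : ℕ) (Φ : ℝ≥0 → Ω → ℝ) : Prop where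
  adapted : ∀ t, Measurable[𝓕 t] (Φ t)
  measurable : Measurable (Function.uncurry Φ)
  version : ∀ t, Φ t =ᵐ[P] oddsRatio P 𝓕 μ θ Λ k t

end PoissonDisorder

end

/-! Before the disorder time the likelihood ratio is 1, so `P` and `P₀` agree on the part of `𝓕 t`
inside `{t < θ}`. Under `P₀` all of `𝓕` is independent of `θ`, hence `P (A ∩ {t < θ}) = (1 - π)
e^{-λt} P₀ A` for `A` in `𝓕 t`. With `p = P(θ ≤ t | 𝓕 t)` and `Φ = p / (1 - p)`, conditioning gives
`P (A ∩ {θ ≤ t}) = E[1_A (1 - p) Φ] = E[1_A 1_{t < θ} Φ] = (1 - π) e^{-λt} E₀[1_A Φ_t]`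
(`IsOddsRatioProcess.nonneg_and_measure_inter_le`).

Delay cost: `(τ - θ)⁺` is the integral of `1_{θ ≤ t < τ}` over `t`, so Tonelli and the identity with
`A = {t < τ}` give the `Φ` term (`lintegral_sub_eq`). False alarm: `P` can be replaced by `P₀` in `P
{τ < θ}` (`measure_stoppingTime_lt_eq`), and independence gives `(1 - π) E₀[e^{-λτ}]`, that is, `1 -
π` minus the `λ` term (`measure_lt_add_lintegral_exp`). That term is bounded, so the two parts
recombine without `∞ - ∞`. -/

namespace PoissonDisorder

/-! ### The two measures coincide before `θ`. -/

section Density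

variable {Ω : Type*} {mΩ : MeasurableSpace Ω} {N : ℝ≥0 → Ω → ℕ} {μ : ℝ≥0} {θ : Ω → ℝ≥0}
  {Λ : Ω → ℝ} {t : ℝ≥0} {ω : Ω}

lemma leftLim_intensity_of_le {s : ℝ≥0} (h : s ≤ θ ω) (h0 : 0 < s) :
    Function.leftLim (fun u ↦ intensity μ θ Λ u ω) s = μ := by
  have : (nhdsWithin s (Iio s)).NeBot := nhdsLT_neBot_of_exists_lt ⟨0, h0⟩
  refine leftLim_eq_of_tendsto (tendsto_const_nhds.congr' ?_)
  filter_upwards [self_mem_nhdsWithin] with u hu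
  have : u < θ ω := lt_of_lt_of_le hu h
  simp [intensity, this]

lemma density_eq_one (hμ : 0 < μ) (h : t < θ ω) : density N μ θ Λ t ω = 1 := by
  have h1 : logIntegral N μ θ Λ t ω = 0 := by
    unfold logIntegral
    refine finsum_mem_eq_zero_of_forall_eq_zero fun s hs ↦ ?_
    have hμ' : (μ : ℝ) ≠ 0 := by exact_mod_cast hμ.ne'
    -- Each summand is a multiple of `log 1`, so finiteness of the set of jumps plays no role.
    rw [leftLim_intensity_of_le (hs.1.2.trans h.le) hs.1.1, div_self hμ']
    simp
  have h2 : ∫ s in (0 : ℝ)..t, (intensity μ θ Λ s.toNNReal ω - μ) = 0 := by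
    rw [intervalIntegral.integral_congr (g := fun _ ↦ 0)]
    · simp
    · intro s hs
      rw [uIcc_of_le (by exact_mod_cast t.2)] at hs
      have : s.toNNReal < θ ω := (Real.toNNReal_le_iff_le_coe.2 hs.2).trans_lt h
      simp [intensity, this]
  simp [density, h1, h2]

lemma measure_inter_lt_eq (P₀ P : Measure Ω) (hμ : 0 < μ) (hθ : Measurable θ)
    (𝓕 : Filtration ℝ≥0 mΩ)
    (hP : ∀ (t : ℝ≥0) (A : Set Ω), MeasurableSet[enlarged 𝓕 θ Λ t] A →
      P A = ∫⁻ ω in A, density N μ θ Λ t ω ∂P₀)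
    {A : Set Ω} (hA : MeasurableSet[𝓕 t] A) :
    P (A ∩ {ω | t < θ ω}) = P₀ (A ∩ {ω | t < θ ω}) := by
  have hA' : MeasurableSet[enlarged 𝓕 θ Λ t] A :=
    (le_sup_left.trans le_sup_left : 𝓕 t ≤ enlarged 𝓕 θ Λ t) _ hA
  have hθ' : MeasurableSet[enlarged 𝓕 θ Λ t] {ω | t < θ ω} := by
    have h : MeasurableSet[MeasurableSpace.comap θ inferInstance] {ω | t < θ ω} :=
      ⟨Ioi t, measurableSet_Ioi, rfl⟩
    have hle : MeasurableSpace.comap θ inferInstance ≤ enlarged 𝓕 θ Λ t :=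
      le_sup_right.trans le_sup_left
    exact hle _ h
  rw [hP t _ (hA'.inter hθ')]
  have hm : MeasurableSet (A ∩ {ω | t < θ ω}) :=
    (𝓕.le t _ hA).inter (measurableSet_lt measurable_const hθ)
  rw [setLIntegral_congr_fun hm (g := fun _ ↦ 1) fun ω hω ↦ density_eq_one hμ hω.2]
  simp

end Density

/-! ### Independence of the observations and `θ`, despite the enlargements. -/

section Independence

variable {Ω : Type*} {mΩ : MeasurableSpace Ω} {P₀ : Measure Ω}

/-- Independence only involves measures of events, so it survives replacing events by almost surely
equal ones. -/
lemma indep_of_le_eventuallyMeasurableSpace {m₁ m₁' m₂ : MeasurableSpace Ω}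
    (h : Indep m₁ m₂ P₀) (hle : m₁' ≤ eventuallyMeasurableSpace m₁ (ae P₀)) :
    Indep m₁' m₂ P₀ := by
  rw [Indep_iff] at h ⊢
  intro A B hA hB
  obtain ⟨A', hA', hAA'⟩ := hle A hA
  rw [measure_congr hAA', ← h A' B hA' hB]
  exact measure_congr (hAA'.inter (Filter.EventuallyEq.refl _ _))

lemma obsFiltration_le_eventuallyMeasurableSpace {N : ℝ≥0 → Ω → ℕ} (hN : ∀ t, Measurable (N t))
    {𝓝 : Set (Set Ω)} (h𝓝 : ∀ A ∈ 𝓝, MeasurableSet A) (h0 : ∀ A ∈ 𝓝, P₀ A = 0) (t : ℝ≥0) :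
    obsFiltration N hN 𝓝 h𝓝 t ≤
      eventuallyMeasurableSpace (MeasurableSpace.comap (fun ω t ↦ N t ω) MeasurableSpace.pi)
        (ae P₀) := by
  rw [obsFiltration, Filtration.rightCont_eq]
  -- Any single time after `t` bounds the right limit; only the whole path matters for independence.
  refine (iInf₂_le (t + 1) (lt_add_one t)).trans (sup_le ?_ ?_)
  · refine le_trans ?_ le_eventuallyMeasurableSpace
    refine iSup₂_le fun s _ ↦ ?_
    rintro _ ⟨B, hB, rfl⟩
    refine ⟨(fun x : ℝ≥0 → ℕ ↦ x s) ⁻¹' B,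
      measurable_pi_apply s MeasurableSet.of_discrete, rfl⟩
  · refine MeasurableSpace.generateFrom_le fun A hA ↦ ?_
    exact ⟨∅, @MeasurableSet.empty _ (_), ae_eq_empty.2 (h0 A hA)⟩

lemma indep_obsFiltration {β : Type*} [MeasurableSpace β] {N : ℝ≥0 → Ω → ℕ}
    (hN : ∀ t, Measurable (N t)) {X : Ω → β} (h : IndepFun X (fun ω t ↦ N t ω) P₀)
    {𝓝 : Set (Set Ω)} (h𝓝 : ∀ A ∈ 𝓝, MeasurableSet A) (h0 : ∀ A ∈ 𝓝, P₀ A = 0) :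
    Indep (⨆ t, obsFiltration N hN 𝓝 h𝓝 t) (MeasurableSpace.comap X inferInstance) P₀ :=
  indep_of_le_eventuallyMeasurableSpace (Indep.symm ((IndepFun_iff_Indep _ _ _).1 h))
    (iSup_le fun t ↦ obsFiltration_le_eventuallyMeasurableSpace hN h𝓝 h0 t)

end Independence

/-! ### Change of measure through the posterior odds. -/

section OddsRatio

variable {Ω : Type*} {m mΩ : MeasurableSpace Ω} {P₀ P : Measure Ω}
  {𝓕 : Filtration ℝ≥0 mΩ} {μ : ℝ≥0} {θ : Ω → ℝ≥0} {Λ : Ω → ℝ} {k : ℝ≥0∞} {t : ℝ≥0}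
  {Φ : ℝ≥0 → Ω → ℝ}

lemma condProb_nonneg {S : Set Ω} :
    ∀ᵐ ω ∂P, 0 ≤ (P[S.indicator (fun _ ↦ (1 : ℝ)) | m]) ω :=
  condExp_nonneg (ae_of_all _ fun ω ↦ indicator_nonneg (by simp) ω)

lemma measure_inter_eq_lintegral_condProb [IsProbabilityMeasure P] (hm : m ≤ mΩ) {S : Set Ω}
    (hS : MeasurableSet S) {A : Set Ω} (hA : MeasurableSet[m] A) :
    P (A ∩ S) = ∫⁻ ω in A, ENNReal.ofReal ((P[S.indicator (fun _ ↦ (1 : ℝ)) | m]) ω) ∂P := by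
  rw [← ofReal_integral_eq_lintegral_ofReal integrable_condExp.integrableOn
    (ae_restrict_of_ae condProb_nonneg), setIntegral_condExp hm
    ((integrable_const (1 : ℝ)).indicator hS) hA, setIntegral_indicator hS]
  simp

lemma measure_inter_compl_eq_lintegral_condProb [IsProbabilityMeasure P] (hm : m ≤ mΩ) {S : Set Ω}
    (hS : MeasurableSet S) {A : Set Ω} (hA : MeasurableSet[m] A) :
    P (A ∩ Sᶜ) =
      ∫⁻ ω in A, ENNReal.ofReal (1 - (P[S.indicator (fun _ ↦ (1 : ℝ)) | m]) ω) ∂P := by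
  rw [measure_inter_eq_lintegral_condProb hm hS.compl hA]
  refine lintegral_congr_ae (ae_restrict_of_ae ?_)
  have h1 : Sᶜ.indicator (fun _ ↦ (1 : ℝ)) = (fun _ ↦ 1) - S.indicator (fun _ ↦ (1 : ℝ)) := by
    rw [indicator_compl]
  have h2 := condExp_sub (μ := P) (integrable_const (1 : ℝ))
    ((integrable_const (1 : ℝ)).indicator hS) m
  rw [condExp_const hm] at h2
  filter_upwards [h2] with ω hω
  rw [h1, hω]
  simp

/-- On `{p ≥ 1}` the event `Sᶜ` is `P`-null. By `h1` that set is then `P₀`-null, and by `h2` also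
`P`-null. This keeps the odds `p / (1 - p)` away from division by zero. -/
lemma condProb_lt_one [IsProbabilityMeasure P] (hm : m ≤ mΩ) {S : Set Ω}
    (hS : MeasurableSet S) (hk : k ≠ 0)
    (h1 : ∀ A, MeasurableSet[m] A → P (A ∩ Sᶜ) = k * P₀ A)
    (h2 : ∀ A, MeasurableSet[m] A → P₀ A = 0 → P A = 0) :
    ∀ᵐ ω ∂P, (P[S.indicator (fun _ ↦ (1 : ℝ)) | m]) ω < 1 := by
  have hB : MeasurableSet[m] {ω | 1 ≤ (P[S.indicator (fun _ ↦ (1 : ℝ)) | m]) ω} :=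
    stronglyMeasurable_condExp.measurable measurableSet_Ici
  have h : P ({ω | 1 ≤ (P[S.indicator (fun _ ↦ (1 : ℝ)) | m]) ω} ∩ Sᶜ) = 0 := by
    rw [measure_inter_compl_eq_lintegral_condProb hm hS hB,
      setLIntegral_congr_fun (hm _ hB) (g := fun _ ↦ 0)
        fun ω hω ↦ ENNReal.ofReal_of_nonpos (sub_nonpos.2 hω)]
    simp
  rw [h1 _ hB] at h
  have h' := h2 _ hB ((mul_eq_zero.1 h).resolve_left hk)
  rw [ae_iff]
  simpa using h'

/-- Since `k ≠ 0`, `P₀` is absolutely continuous with respect to `P` on `m`. This carries facts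
about adapted versions from `P` back to `P₀`. -/
lemma ae_of_ae_of_measure_inter {S : Set Ω} (hk : k ≠ 0)
    (h1 : ∀ A, MeasurableSet[m] A → P (A ∩ S) = k * P₀ A) {p : Ω → Prop}
    (hp : MeasurableSet[m] {ω | p ω}) (h : ∀ᵐ ω ∂P, p ω) : ∀ᵐ ω ∂P₀, p ω := by
  have h' := h1 _ hp.compl
  rw [measure_mono_null inter_subset_left (show P {ω | p ω}ᶜ = 0 from ae_iff.1 h)] at h'
  exact ae_iff.2 ((mul_eq_zero.1 h'.symm).resolve_left hk)

lemma setLIntegral_of_measure_inter (hm : m ≤ mΩ) {S : Set Ω}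
    (h1 : ∀ A, MeasurableSet[m] A → P (A ∩ S) = k * P₀ A)
    {f : Ω → ℝ≥0∞} (hf : Measurable[m] f) : ∫⁻ ω in S, f ω ∂P = k * ∫⁻ ω, f ω ∂P₀ := by
  have h : (P.restrict S).trim hm = k • P₀.trim hm := by
    refine @Measure.ext _ m _ _ fun A hA ↦ ?_
    rw [trim_measurableSet_eq hm hA, Measure.restrict_apply (hm _ hA), h1 A hA,
      Measure.smul_apply, trim_measurableSet_eq hm hA, smul_eq_mul]
  rw [← lintegral_trim hm hf, h, lintegral_smul_measure, lintegral_trim hm hf, smul_eq_mul]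

/-- Pulling out an `m`-measurable factor; comparing measures trimmed to `m` avoids any integrability
of `f`. -/
lemma setLIntegral_compl_eq_lintegral_condProb_mul [IsProbabilityMeasure P] (hm : m ≤ mΩ)
    {S : Set Ω} (hS : MeasurableSet S) {f : Ω → ℝ≥0∞} (hf : Measurable[m] f) :
    ∫⁻ ω in Sᶜ, f ω ∂P =
      ∫⁻ ω, ENNReal.ofReal (1 - (P[S.indicator (fun _ ↦ (1 : ℝ)) | m]) ω) * f ω ∂P := by
  have hg : Measurable[m]
      fun ω ↦ ENNReal.ofReal (1 - (P[S.indicator (fun _ ↦ (1 : ℝ)) | m]) ω) :=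
    (measurable_const.sub stronglyMeasurable_condExp.measurable).ennreal_ofReal
  have h : (P.restrict Sᶜ).trim hm = (P.withDensity
      fun ω ↦ ENNReal.ofReal (1 - (P[S.indicator (fun _ ↦ (1 : ℝ)) | m]) ω)).trim hm := by
    refine @Measure.ext _ m _ _ fun A hA ↦ ?_
    rw [trim_measurableSet_eq hm hA, Measure.restrict_apply (hm _ hA),
      measure_inter_compl_eq_lintegral_condProb hm hS hA, trim_measurableSet_eq hm hA,
      withDensity_apply _ (hm _ hA)]
  rw [← lintegral_trim hm hf, h, lintegral_trim hm hf,
    lintegral_withDensity_eq_lintegral_mul _ (hg.mono hm le_rfl) (hf.mono hm le_rfl)]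
  rfl

lemma IsOddsRatioProcess.nonneg_and_measure_inter_le [IsProbabilityMeasure P] (hθ : Measurable θ)
    (hΦ : IsOddsRatioProcess P 𝓕 μ θ Λ 0 Φ) (hk : k ≠ 0)
    (h1 : ∀ A, MeasurableSet[𝓕 t] A → P (A ∩ {ω | t < θ ω}) = k * P₀ A)
    (h2 : ∀ A, MeasurableSet[𝓕 t] A → P₀ A = 0 → P A = 0) :
    (∀ᵐ ω ∂P₀, 0 ≤ Φ t ω) ∧
    ∀ A, MeasurableSet[𝓕 t] A →
      P (A ∩ {ω | θ ω ≤ t}) = k * ∫⁻ ω in A, ENNReal.ofReal (Φ t ω) ∂P₀ := by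
  have hm := 𝓕.le t
  have hS : MeasurableSet {ω | θ ω ≤ t} := measurableSet_le hθ measurable_const
  have hSc : {ω | θ ω ≤ t}ᶜ = {ω | t < θ ω} := by ext; simp
  have hlt : ∀ᵐ ω ∂P, (P[{ω | θ ω ≤ t}.indicator (fun _ ↦ (1 : ℝ)) | 𝓕 t]) ω < 1 :=
    condProb_lt_one hm hS hk (by rwa [hSc]) h2
  have hver : ∀ᵐ ω ∂P, Φ t ω = (P[{ω | θ ω ≤ t}.indicator (fun _ ↦ (1 : ℝ)) | 𝓕 t]) ω /
      (1 - (P[{ω | θ ω ≤ t}.indicator (fun _ ↦ (1 : ℝ)) | 𝓕 t]) ω) := by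
    simpa [oddsRatio, Filter.EventuallyEq] using hΦ.version t
  have hnn : ∀ᵐ ω ∂P, 0 ≤ Φ t ω := by
    filter_upwards [hlt, hver, condProb_nonneg (P := P) (m := 𝓕 t) (S := {ω | θ ω ≤ t})]
      with ω h h' h''
    rw [h']
    exact div_nonneg h'' (sub_nonneg.2 h.le)
  refine ⟨ae_of_ae_of_measure_inter hk h1
    (hΦ.adapted t measurableSet_Ici) hnn, fun A hA ↦ ?_⟩
  have hf : Measurable[𝓕 t] (A.indicator fun ω ↦ ENNReal.ofReal (Φ t ω)) :=
    (hΦ.adapted t).ennreal_ofReal.indicator hA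
  rw [← lintegral_indicator (hm _ hA), ← setLIntegral_of_measure_inter hm h1 hf, ← hSc,
    setLIntegral_compl_eq_lintegral_condProb_mul hm hS hf,
    measure_inter_eq_lintegral_condProb hm hS hA, ← lintegral_indicator (hm _ hA)]
  refine lintegral_congr_ae ?_
  filter_upwards [hlt, hver, hnn] with ω h h' h''
  by_cases hω : ω ∈ A
  · simp only [indicator_of_mem hω]
    rw [← ENNReal.ofReal_mul (sub_nonneg.2 h.le), h', mul_div_cancel₀]
    exact (sub_pos.2 h).ne'
  · simp [hω]

end OddsRatio

/-! ### Stopping times: measurability and discretization. -/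

section StoppingTime

variable {Ω : Type*} {mΩ : MeasurableSpace Ω} {P₀ P : Measure Ω} {𝓕 : Filtration ℝ≥0 mΩ}
  {θ : Ω → ℝ≥0} {τ : Ω → ℝ≥0∞}

lemma measurable_of_isStoppingTime (hτ : IsStoppingTime 𝓕 τ) : Measurable[⨆ t, 𝓕 t] τ := by
  refine @measurable_of_Iio _ _ _ _ _ (⨆ t, 𝓕 t) _ _ _ _ fun x ↦ ?_
  have : τ ⁻¹' Iio x = ⋃ (q : ℚ) (_ : ((q : ℝ).toNNReal : ℝ≥0∞) < x),
      {ω | τ ω ≤ ((q : ℝ).toNNReal : ℝ≥0∞)} := by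
    ext ω
    simp only [mem_preimage, mem_Iio, mem_iUnion, mem_ofPred_eq, exists_prop]
    constructor
    · intro h
      obtain ⟨q, -, hq1, hq2⟩ := ENNReal.lt_iff_exists_rat_btwn.1 h
      exact ⟨q, hq2, hq1.le⟩
    · rintro ⟨q, hq1, hq2⟩
      exact hq2.trans_lt hq1
  rw [this]
  refine MeasurableSet.iUnion fun q ↦ MeasurableSet.iUnion fun _ ↦ ?_
  exact le_iSup (fun t ↦ (𝓕 t : MeasurableSpace Ω)) (q : ℝ).toNNReal _ (hτ (q : ℝ).toNNReal)

/-- Discretize time with mesh `1 / (n + 1)`. If `τ` lies in a cell and `θ` exceeds its right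
endpoint, `h` applies at that endpoint. The unions over cells need not increase with `n`, but their
indicators converge pointwise to that of `{τ < θ}`. -/
lemma measure_stoppingTime_lt_eq [IsFiniteMeasure P₀] [IsFiniteMeasure P] (hθ : Measurable θ)
    (hτ : IsStoppingTime 𝓕 τ)
    (h : ∀ (t : ℝ≥0) (A : Set Ω), MeasurableSet[𝓕 t] A →
      P (A ∩ {ω | t < θ ω}) = P₀ (A ∩ {ω | t < θ ω})) :
    P {ω | τ ω < θ ω} = P₀ {ω | τ ω < θ ω} := by
  let s : ℕ → ℕ → ℝ≥0 := fun n k ↦ k / (n + 1)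
  let A : ℕ → ℕ → Set Ω := fun n k ↦ {ω | s n k ≤ τ ω} ∩ {ω | τ ω < s n (k + 1)}
  have hs : ∀ n, Monotone (s n) := fun n k l hkl ↦ by
    simp only [s]; gcongr
  have hA : ∀ n k, MeasurableSet[𝓕 (s n (k + 1))] (A n k) := fun n k ↦
    (𝓕.mono (hs n k.le_succ) _ (hτ.measurableSet_ge _)).inter (hτ.measurableSet_lt _)
  have hm : ∀ n k, MeasurableSet (A n k ∩ {ω | s n (k + 1) < θ ω}) := fun n k ↦
    (𝓕.le _ _ (hA n k)).inter (measurableSet_lt measurable_const hθ)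
  have hd : ∀ n, Pairwise (Function.onFun Disjoint fun k ↦ A n k ∩ {ω | s n (k + 1) < θ ω}) := by
    intro n
    refine (pairwise_disjoint_on _).2 fun k l hkl ↦ disjoint_left.2 fun ω hk hl ↦ ?_
    have h1 : τ ω < s n (k + 1) := hk.1.2
    have h2 : (s n l : ℝ≥0∞) ≤ τ ω := hl.1.1
    have h3 : s n (k + 1) ≤ s n l := hs n hkl
    exact absurd (h1.trans_le ((ENNReal.coe_le_coe.2 h3).trans h2)) (lt_irrefl _)
  have hE : ∀ n, P (⋃ k, A n k ∩ {ω | s n (k + 1) < θ ω}) =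
      P₀ (⋃ k, A n k ∩ {ω | s n (k + 1) < θ ω}) := fun n ↦ by
    rw [measure_iUnion (hd n) (hm n), measure_iUnion (hd n) (hm n)]
    exact tsum_congr fun k ↦ h _ _ (hA n k)
  have hlim : ∀ ω, ∀ᶠ n in Filter.atTop,
      ω ∈ (⋃ k, A n k ∩ {ω | s n (k + 1) < θ ω}) ↔ ω ∈ {ω | τ ω < θ ω} := by
    intro ω
    by_cases hω : τ ω < θ ω
    · obtain ⟨r, hr⟩ := ENNReal.lt_iff_exists_coe.1 hω
      obtain ⟨hr1, hr2⟩ := hr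
      rw [ENNReal.coe_lt_coe] at hr2
      have hpos : 0 < θ ω - r := tsub_pos_of_lt hr2
      -- Once the mesh is below `θ ω - τ ω`, the right endpoint of the cell containing `τ ω` is
      -- still less than `θ ω`.
      obtain ⟨m, hm⟩ := exists_nat_one_div_lt (K := ℝ≥0) hpos
      filter_upwards [Filter.eventually_ge_atTop m] with n hn
      refine iff_of_true (mem_iUnion.2 ⟨⌊(n + 1) * r⌋₊, ?_⟩) hω
      have hn0 : (0 : ℝ≥0) < n + 1 := by positivity
      have h1 : s n ⌊(n + 1) * r⌋₊ ≤ r := by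
        simp only [s]
        rw [div_le_iff₀' hn0]
        exact Nat.floor_le (by positivity)
      have h2 : r < s n (⌊(n + 1) * r⌋₊ + 1) := by
        simp only [s]
        rw [lt_div_iff₀' hn0]
        exact_mod_cast Nat.lt_floor_add_one ((n + 1) * r)
      have h3 : s n (⌊(n + 1) * r⌋₊ + 1) < θ ω := by
        have h4 : s n (⌊(n + 1) * r⌋₊ + 1) = s n ⌊(n + 1) * r⌋₊ + 1 / (n + 1) := by
          simp only [s, Nat.cast_add, Nat.cast_one, add_div]
        have h5 : (1 : ℝ≥0) / (n + 1) ≤ 1 / (m + 1) := by gcongr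
        rw [h4]
        calc _ ≤ r + 1 / (m + 1) := add_le_add h1 h5
          _ < r + (θ ω - r) := by gcongr
          _ = θ ω := add_tsub_cancel_of_le hr2.le
      refine ⟨⟨?_, ?_⟩, h3⟩
      · simpa [hr1] using h1
      · simpa [hr1] using h2
    · refine Filter.Eventually.of_forall fun n ↦ iff_of_false (fun hn ↦ hω ?_) hω
      obtain ⟨k, ⟨_, hk⟩, hk'⟩ := mem_iUnion.1 hn
      exact lt_trans hk (ENNReal.coe_lt_coe.2 hk')
  have hP := tendsto_measure_of_tendsto_indicator_of_isFiniteMeasure Filter.atTop P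
    (fun n ↦ MeasurableSet.iUnion (hm n)) hlim
  have hP₀ := tendsto_measure_of_tendsto_indicator_of_isFiniteMeasure Filter.atTop P₀
    (fun n ↦ MeasurableSet.iUnion (hm n)) hlim
  exact tendsto_nhds_unique hP (by simpa only [hE] using hP₀)

end StoppingTime

/-! ### Integrals over the random interval `[0, τ)`. -/

section TimeIntegral

lemma setOf_time_top : {t : ℝ | 0 ≤ t ∧ ENNReal.ofReal t < ∞} = Ici 0 := by
  ext t; simp

lemma setOf_time_coe (r : ℝ≥0) : {t : ℝ | 0 ≤ t ∧ ENNReal.ofReal t < r} = Ico 0 (r : ℝ) := by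
  ext t
  simp only [mem_ofPred_eq, mem_Ico, and_congr_right_iff]
  intro ht
  rw [← ENNReal.ofReal_coe_nnreal, ENNReal.ofReal_lt_ofReal_iff_of_nonneg ht]

lemma measurableSet_time (s : ℝ≥0∞) : MeasurableSet {t : ℝ | 0 ≤ t ∧ ENNReal.ofReal t < s} :=
  (measurableSet_le measurable_const measurable_id).inter
    (measurableSet_lt ENNReal.measurable_ofReal measurable_const)

/-- The exponential law splits into its mass before `s` and its tail. The case `s = ∞` is separate
because `toReal` sends `∞` to `0`, which would give tail `1`. -/
lemma setLIntegral_exp_time {lam : ℝ} (hlam : 0 < lam) (s : ℝ≥0∞) :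
    (∫⁻ t in {t : ℝ | 0 ≤ t ∧ ENNReal.ofReal t < s}, ENNReal.ofReal (lam * Real.exp (-lam * t))) +
      (if s = ∞ then 0 else ENNReal.ofReal (Real.exp (-lam * s.toReal))) = 1 := by
  have h : ∫⁻ t in {t : ℝ | 0 ≤ t ∧ ENNReal.ofReal t < s},
      ENNReal.ofReal (lam * Real.exp (-lam * t)) =
      ∫⁻ t in {t : ℝ | 0 ≤ t ∧ ENNReal.ofReal t < s}, exponentialPDF lam t := by
    refine setLIntegral_congr_fun (measurableSet_time s) fun t ht ↦ ?_
    rw [exponentialPDF_of_nonneg ht.1, neg_mul]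
  have hneg : ∫⁻ t in Iio (0 : ℝ), exponentialPDF lam t = 0 :=
    lintegral_exponentialPDF_of_nonpos le_rfl
  rw [h]
  induction s with
  | top =>
    rw [setOf_time_top, ← lintegral_exponentialPDF_eq_one hlam,
      ← lintegral_add_compl (μ := volume) (exponentialPDF lam) (measurableSet_Ici (a := (0 : ℝ))), compl_Ici,
      hneg]
    simp
  | coe r =>
    rw [setOf_time_coe, setLIntegral_congr Ico_ae_eq_Icc]
    have := lintegral_exponentialPDF_eq_antiDeriv hlam r
    rw [lintegral_Iic_eq_lintegral_Iio_add_Icc _ r.coe_nonneg, hneg, zero_add,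
      if_pos r.coe_nonneg] at this
    rw [this, if_neg ENNReal.coe_ne_top, ENNReal.coe_toReal, ← neg_mul, ← ENNReal.ofReal_add]
    · simp
    · simp only [sub_nonneg, Real.exp_le_one_iff]
      nlinarith [r.coe_nonneg]
    · positivity

lemma volume_time_sub (a : ℝ≥0∞) (b : ℝ≥0) :
    volume ({t : ℝ | 0 ≤ t ∧ ENNReal.ofReal t < a} ∩ {t | b ≤ t.toNNReal}) = a - b := by
  induction a with
  | top =>
    have : {t : ℝ | 0 ≤ t ∧ ENNReal.ofReal t < ∞} ∩ {t | b ≤ t.toNNReal} = Ici (b : ℝ) := by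
      ext t
      simp only [setOf_time_top, mem_inter_iff, mem_Ici, mem_ofPred_eq]
      constructor
      · rintro ⟨h1, h2⟩
        exact (Real.le_toNNReal_iff_coe_le h1).1 h2
      · intro h
        have h1 := b.2.trans h
        exact ⟨h1, (Real.le_toNNReal_iff_coe_le h1).2 h⟩
    rw [this]
    simp
  | coe r =>
    have : {t : ℝ | 0 ≤ t ∧ ENNReal.ofReal t < r} ∩ {t | b ≤ t.toNNReal} = Ico (b : ℝ) r := by
      ext t
      simp only [setOf_time_coe, mem_inter_iff, mem_Ico, mem_ofPred_eq]
      constructor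
      · rintro ⟨⟨h1, h3⟩, h2⟩
        exact ⟨(Real.le_toNNReal_iff_coe_le h1).1 h2, h3⟩
      · rintro ⟨h, h3⟩
        have h1 := b.2.trans h
        exact ⟨⟨h1, h3⟩, (Real.le_toNNReal_iff_coe_le h1).2 h⟩
    rw [this, Real.volume_Ico, ENNReal.ofReal_sub _ (NNReal.coe_nonneg b),
      ENNReal.ofReal_coe_nnreal, ENNReal.ofReal_coe_nnreal]

lemma lintegral_time_swap {Ω : Type*} {mΩ : MeasurableSpace Ω} {Q : Measure Ω} [SFinite Q]
    {τ : Ω → ℝ≥0∞} (hτ : Measurable τ) {F : ℝ → Ω → ℝ≥0∞} (hF : Measurable (Function.uncurry F)) :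
    ∫⁻ ω, (∫⁻ t in {t : ℝ | 0 ≤ t ∧ ENNReal.ofReal t < τ ω}, F t ω) ∂Q =
      ∫⁻ t in Ici (0 : ℝ), ∫⁻ ω in {ω | ENNReal.ofReal t < τ ω}, F t ω ∂Q := by
  have hS : MeasurableSet {p : ℝ × Ω | ENNReal.ofReal p.1 < τ p.2} :=
    measurableSet_lt (ENNReal.measurable_ofReal.comp measurable_fst) (hτ.comp measurable_snd)
  have hG := hF.indicator hS
  calc _ = ∫⁻ ω, (∫⁻ t in Ici (0 : ℝ),
        {p : ℝ × Ω | ENNReal.ofReal p.1 < τ p.2}.indicator (Function.uncurry F) (t, ω)) ∂Q := by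
        refine lintegral_congr fun ω ↦ ?_
        have h : MeasurableSet {t : ℝ | ENNReal.ofReal t < τ ω} :=
          measurableSet_lt ENNReal.measurable_ofReal measurable_const
        have h' : {t : ℝ | 0 ≤ t ∧ ENNReal.ofReal t < τ ω} =
          {t : ℝ | ENNReal.ofReal t < τ ω} ∩ Ici 0 := by ext; simp [and_comm]
        rw [h', ← Measure.restrict_restrict h, ← lintegral_indicator h]
        rfl
    _ = ∫⁻ t in Ici (0 : ℝ), ∫⁻ ω,
        {p : ℝ × Ω | ENNReal.ofReal p.1 < τ p.2}.indicator (Function.uncurry F) (t, ω) ∂Q :=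
        lintegral_lintegral_swap (hG.comp measurable_swap).aemeasurable
    _ = _ := by
        refine lintegral_congr fun t ↦ ?_
        rw [← lintegral_indicator (measurableSet_lt measurable_const hτ)]
        rfl

end TimeIntegral

/-! ### Extended integrals of differences. -/

section ExtIntegral

variable {α : Type*} [MeasurableSpace α] {m : Measure α}

lemma toENNReal_coe_sub_add {u d : ℝ≥0∞} (hd : d ≠ ∞) :
    ((u : EReal) - d).toENNReal + d = u + (-((u : EReal) - d)).toENNReal := by
  lift d to ℝ≥0 using hd
  induction u with
  | top =>
    simp
  | coe u =>
    have h : ((u : ℝ≥0∞) : EReal) - ((d : ℝ≥0∞) : EReal) = ((u - d : ℝ) : EReal) := by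
      rw [EReal.coe_sub]; rfl
    rw [h, ← EReal.coe_neg, EReal.toENNReal_of_ne_top (EReal.coe_ne_top _),
      EReal.toENNReal_of_ne_top (EReal.coe_ne_top _), EReal.toReal_coe, EReal.toReal_coe,
      ← ENNReal.ofReal_coe_nnreal (p := u), ← ENNReal.ofReal_coe_nnreal (p := d)]
    rcases le_total (u : ℝ) d with h | h
    · rw [ENNReal.ofReal_of_nonpos (sub_nonpos.2 h), zero_add,
        ← ENNReal.ofReal_add u.coe_nonneg (by linarith)]
      congr 1; ring
    · rw [ENNReal.ofReal_of_nonpos (p := -((u : ℝ) - d)) (by linarith), add_zero,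
        ← ENNReal.ofReal_add (by linarith) d.coe_nonneg]
      congr 1; ring

lemma toENNReal_neg_coe_sub_le {u d : ℝ≥0∞} (hd : d ≠ ∞) :
    (-((u : EReal) - d)).toENNReal ≤ d := by
  rw [EReal.neg_sub (Or.inl (EReal.coe_ennreal_ne_bot u))
    (Or.inr (by simpa using hd))]
  conv_rhs => rw [← EReal.toENNReal_coe (x := d)]
  refine EReal.toENNReal_le_toENNReal ?_
  calc -(u : EReal) + d ≤ 0 + d := by
        gcongr
        simpa using EReal.coe_ennreal_nonneg u
    _ = d := zero_add _

lemma ereal_coe_sub_eq_of_add_eq {a b u d : ℝ≥0∞} (hb : b ≠ ∞) (hd : d ≠ ∞)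
    (h : a + d = u + b) : (a : EReal) - b = (u : EReal) - d := by
  lift b to ℝ≥0 using hb
  lift d to ℝ≥0 using hd
  induction a with
  | top =>
    have : u = ∞ := by
      by_contra hu
      exact ENNReal.add_ne_top.2 ⟨hu, ENNReal.coe_ne_top⟩ (by rw [← h, top_add])
    subst this
    change (⊤ : EReal) - ((b : ℝ) : EReal) = ⊤ - ((d : ℝ) : EReal)
    rw [EReal.top_sub_coe, EReal.top_sub_coe]
  | coe a =>
    have hu : u ≠ ∞ := by
      rintro rfl
      rw [top_add] at h
      exact ENNReal.add_ne_top.2 ⟨ENNReal.coe_ne_top, ENNReal.coe_ne_top⟩ h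
    lift u to ℝ≥0 using hu
    have h' : (a : ℝ) + d = u + b := by exact_mod_cast h
    change ((a : ℝ) : EReal) - ((b : ℝ) : EReal) = ((u : ℝ) : EReal) - ((d : ℝ) : EReal)
    rw [← EReal.coe_sub, ← EReal.coe_sub, EReal.coe_eq_coe_iff]
    linarith

/-- Integrate `f⁺ + d = u + f⁻` and rearrange; this is legitimate because `f⁻ ≤ d` and `d` has
finite integral. Here `u` and `d` need not be the positive and negative parts, and `∫ u` may be
infinite. -/
lemma extIntegral_eq_sub {f : α → EReal} {u d : α → ℝ≥0∞} (hu : AEMeasurable u m)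
    (hd : AEMeasurable d m) (hd_top : ∫⁻ x, d x ∂m ≠ ∞)
    (h : ∀ᵐ x ∂m, f x = (u x : EReal) - d x) :
    extIntegral m f = ((∫⁻ x, u x ∂m : ℝ≥0∞) : EReal) - ((∫⁻ x, d x ∂m : ℝ≥0∞) : EReal) := by
  have hfin : ∀ᵐ x ∂m, d x < ∞ := ae_lt_top' hd hd_top
  refine ereal_coe_sub_eq_of_add_eq ?_ hd_top ?_
  · refine ne_top_of_le_ne_top hd_top (lintegral_mono_ae ?_)
    filter_upwards [h, hfin] with x hx hx'
    exact hx ▸ toENNReal_neg_coe_sub_le hx'.ne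
  · rw [← lintegral_add_right' _ hd, ← lintegral_add_left' hu]
    refine lintegral_congr_ae ?_
    filter_upwards [h, hfin] with x hx hx'
    rw [hx, toENNReal_coe_sub_add hx'.ne]

end ExtIntegral

/-! ### The two terms of the risk and their recombination. -/

section BayesRisk

variable {Ω : Type*} {mΩ : MeasurableSpace Ω} {P₀ P : Measure Ω}
  {𝓕 : Filtration ℝ≥0 mΩ} {θ : Ω → ℝ≥0} {τ : Ω → ℝ≥0∞}

lemma measurable_setLIntegral_time (hτ : Measurable τ) {F : ℝ → Ω → ℝ≥0∞}
    (hF : Measurable (Function.uncurry F)) :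
    Measurable fun ω ↦ ∫⁻ t in {t : ℝ | 0 ≤ t ∧ ENNReal.ofReal t < τ ω}, F t ω := by
  have hS : MeasurableSet {p : Ω × ℝ | 0 ≤ p.2 ∧ ENNReal.ofReal p.2 < τ p.1} :=
    (measurableSet_le measurable_const measurable_snd).inter
      (measurableSet_lt (ENNReal.measurable_ofReal.comp measurable_snd) (hτ.comp measurable_fst))
  have h := ((hF.comp measurable_swap).indicator hS).lintegral_prod_right' (ν := volume)
  convert h using 2 with ω
  rw [← lintegral_indicator (measurableSet_time _)]
  rfl

/-- By independence `τ` may be frozen at a value, where the identity is `setLIntegral_exp_time`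
times `q`. The additive form avoids truncated subtraction. -/
lemma measure_lt_add_lintegral_exp [IsProbabilityMeasure P₀] {lam q : ℝ} (hlam : 0 < lam)
    (hq : 0 ≤ q) (hθ : Measurable θ) (hτ : Measurable τ) (hind : IndepFun τ θ P₀)
    (htail : ∀ t : ℝ≥0, P₀ {ω | t < θ ω} = ENNReal.ofReal (q * Real.exp (-lam * t))) :
    P₀ {ω | τ ω < θ ω} + ENNReal.ofReal q *
      ∫⁻ ω, (∫⁻ t in {t : ℝ | 0 ≤ t ∧ ENNReal.ofReal t < τ ω},
        ENNReal.ofReal (lam * Real.exp (-lam * t))) ∂P₀ = ENNReal.ofReal q := by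
  have hF : Measurable (Function.uncurry
      fun (t : ℝ) (_ : Ω) ↦ ENNReal.ofReal (lam * Real.exp (-lam * t))) := by
    unfold Function.uncurry
    fun_prop
  have hS : MeasurableSet {p : ℝ≥0∞ × ℝ≥0 | p.1 < p.2} :=
    measurableSet_lt measurable_fst (measurable_coe_nnreal_ennreal.comp measurable_snd)
  have h1 : P₀ {ω | τ ω < θ ω} = ∫⁻ ω, P₀ {ω' | τ ω < θ ω'} ∂P₀ := by
    have h2 : P₀ {ω | τ ω < θ ω} = P₀.map (fun ω ↦ (τ ω, θ ω)) {p | p.1 < p.2} :=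
      (Measure.map_apply (hτ.prodMk hθ) hS).symm
    rw [h2, (indepFun_iff_map_prod_eq_prod_map_map hτ.aemeasurable hθ.aemeasurable).1 hind,
      Measure.prod_apply hS, lintegral_map (measurable_measure_prodMk_left hS) hτ]
    refine lintegral_congr fun ω ↦ ?_
    rw [Measure.map_apply hθ (measurable_prodMk_left hS)]
    rfl
  rw [h1, ← lintegral_const_mul _ (measurable_setLIntegral_time hτ hF),
    ← lintegral_add_right _ ((measurable_setLIntegral_time hτ hF).const_mul _)]
  have h3 : ∀ ω, P₀ {ω' | τ ω < θ ω'} + ENNReal.ofReal q *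
      (∫⁻ t in {t : ℝ | 0 ≤ t ∧ ENNReal.ofReal t < τ ω},
        ENNReal.ofReal (lam * Real.exp (-lam * t))) = ENNReal.ofReal q := by
    intro ω
    have h4 : P₀ {ω' | τ ω < θ ω'} = ENNReal.ofReal q *
        if τ ω = ∞ then 0 else ENNReal.ofReal (Real.exp (-lam * (τ ω).toReal)) := by
      induction h : τ ω with
      | top => simp
      | coe r =>
        rw [if_neg ENNReal.coe_ne_top, ← ENNReal.ofReal_mul hq, ENNReal.coe_toReal, ← htail r]
        simp
    rw [h4, ← mul_add, add_comm, setLIntegral_exp_time hlam, mul_one]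
  simp_rw [h3]
  simp

lemma lintegral_sub_eq [IsProbabilityMeasure P₀] [IsProbabilityMeasure P] {k : ℝ≥0 → ℝ≥0∞}
    (hk : Measurable k) (hθ : Measurable θ) (hτ : IsStoppingTime 𝓕 τ) (hτm : Measurable τ)
    {Φ : ℝ≥0 → Ω → ℝ} (hΦ : Measurable (Function.uncurry Φ))
    (h : ∀ t A, MeasurableSet[𝓕 t] A →
      P (A ∩ {ω | θ ω ≤ t}) = k t * ∫⁻ ω in A, ENNReal.ofReal (Φ t ω) ∂P₀) :
    ∫⁻ ω, (τ ω - θ ω) ∂P =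
      ∫⁻ ω, (∫⁻ t in {t : ℝ | 0 ≤ t ∧ ENNReal.ofReal t < τ ω},
        k t.toNNReal * ENNReal.ofReal (Φ t.toNNReal ω)) ∂P₀ := by
  have hΦt : ∀ t, Measurable (Φ t) := fun t ↦ hΦ.comp measurable_prodMk_left
  have hT : Measurable (fun p : ℝ × Ω ↦ (p.1.toNNReal, p.2)) :=
    (measurable_real_toNNReal.comp measurable_fst).prodMk measurable_snd
  have hF : Measurable (Function.uncurry fun (t : ℝ) (ω : Ω) ↦
      k t.toNNReal * ENNReal.ofReal (Φ t.toNNReal ω)) :=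
    (hk.comp (measurable_real_toNNReal.comp measurable_fst)).mul (hΦ.comp hT).ennreal_ofReal
  have hB : MeasurableSet {p : ℝ × Ω | θ p.2 ≤ p.1.toNNReal} :=
    measurableSet_le (hθ.comp measurable_snd) (measurable_real_toNNReal.comp measurable_fst)
  have hG : Measurable (Function.uncurry fun (t : ℝ) (ω : Ω) ↦
      {p : ℝ × Ω | θ p.2 ≤ p.1.toNNReal}.indicator (fun _ ↦ (1 : ℝ≥0∞)) (t, ω)) :=
    measurable_const.indicator hB
  rw [lintegral_time_swap hτm hF]
  calc ∫⁻ ω, (τ ω - θ ω) ∂P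
      = ∫⁻ ω, (∫⁻ t in {t : ℝ | 0 ≤ t ∧ ENNReal.ofReal t < τ ω},
        {p : ℝ × Ω | θ p.2 ≤ p.1.toNNReal}.indicator (fun _ ↦ (1 : ℝ≥0∞)) (t, ω)) ∂P := by
        refine lintegral_congr fun ω ↦ ?_
        have hm : MeasurableSet {t : ℝ | θ ω ≤ t.toNNReal} :=
          measurableSet_le measurable_const measurable_real_toNNReal
        have h' : ∀ t : ℝ, {p : ℝ × Ω | θ p.2 ≤ p.1.toNNReal}.indicator
          (fun _ ↦ (1 : ℝ≥0∞)) (t, ω) = {t : ℝ | θ ω ≤ t.toNNReal}.indicator 1 t := fun _ ↦ rfl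
        simp_rw [h']
        rw [lintegral_indicator_one hm, Measure.restrict_apply hm, inter_comm, volume_time_sub]
    _ = ∫⁻ t in Ici (0 : ℝ), P ({ω | ENNReal.ofReal t < τ ω} ∩ {ω | θ ω ≤ t.toNNReal}) := by
        rw [lintegral_time_swap hτm hG]
        refine lintegral_congr fun t ↦ ?_
        have hm : MeasurableSet {ω | θ ω ≤ t.toNNReal} := measurableSet_le hθ measurable_const
        have h' : ∀ ω, {p : ℝ × Ω | θ p.2 ≤ p.1.toNNReal}.indicator
          (fun _ ↦ (1 : ℝ≥0∞)) (t, ω) = {ω | θ ω ≤ t.toNNReal}.indicator 1 ω := fun _ ↦ rfl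
        simp_rw [h']
        rw [lintegral_indicator_one hm, Measure.restrict_apply hm, inter_comm]
    _ = _ := by
        refine lintegral_congr fun t ↦ ?_
        rw [lintegral_const_mul _ (hΦt _).ennreal_ofReal]
        -- The stopping property puts `{t < τ}` in `𝓕 t`.
        exact h _ _ (hτ.measurableSet_gt t.toNNReal)

/-- `extIntegral_eq_sub` is used twice, in `t` and in `ω`: the subtracted part `c⁻¹ λ e^{-λt}` has
time integral at most `c⁻¹`. -/
lemma extIntegral_stopped_eq [IsProbabilityMeasure P₀] {lam c : ℝ} (hlam : 0 < lam) (hc : 0 < c)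
    (hτ : Measurable τ) {Φ : ℝ≥0 → Ω → ℝ} (hΦ : Measurable (Function.uncurry Φ))
    (hΦ0 : ∀ t, ∀ᵐ ω ∂P₀, 0 ≤ Φ t ω) :
    extIntegral P₀ (fun ω ↦
      extIntegral (volume.restrict {t : ℝ | 0 ≤ t ∧ ENNReal.ofReal t < τ ω})
        (fun t ↦ ((Real.exp (-lam * t) * (Φ t.toNNReal ω - lam / c) : ℝ) : EReal))) =
    ((∫⁻ ω, (∫⁻ t in {t : ℝ | 0 ≤ t ∧ ENNReal.ofReal t < τ ω},
        ENNReal.ofReal (Real.exp (-lam * t)) * ENNReal.ofReal (Φ t.toNNReal ω)) ∂P₀ : ℝ≥0∞) :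
          EReal) -
    ((ENNReal.ofReal c⁻¹ * ∫⁻ ω, (∫⁻ t in {t : ℝ | 0 ≤ t ∧ ENNReal.ofReal t < τ ω},
        ENNReal.ofReal (lam * Real.exp (-lam * t))) ∂P₀ : ℝ≥0∞) : EReal) := by
  have hT : Measurable (fun p : ℝ × Ω ↦ (p.1.toNNReal, p.2)) :=
    (measurable_real_toNNReal.comp measurable_fst).prodMk measurable_snd
  have hF : Measurable (Function.uncurry fun (t : ℝ) (ω : Ω) ↦
      ENNReal.ofReal (Real.exp (-lam * t)) * ENNReal.ofReal (Φ t.toNNReal ω)) :=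
    Measurable.mul (by fun_prop) (hΦ.comp hT).ennreal_ofReal
  have hE : Measurable (Function.uncurry
      fun (t : ℝ) (_ : Ω) ↦ ENNReal.ofReal (lam * Real.exp (-lam * t))) := by
    unfold Function.uncurry
    fun_prop
  have hle : ∀ ω, ∫⁻ t in {t : ℝ | 0 ≤ t ∧ ENNReal.ofReal t < τ ω},
      ENNReal.ofReal (lam * Real.exp (-lam * t)) ≤ 1 := fun ω ↦
    le_self_add.trans_eq (setLIntegral_exp_time hlam (τ ω))
  have hmE := measurable_setLIntegral_time hτ hE
  -- The exceptional null set depends on `t`; joint measurability and Fubini exchange the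
  -- quantifiers.
  have hnn : ∀ᵐ ω ∂P₀, ∀ᵐ t : ℝ, 0 ≤ Φ t.toNNReal ω := by
    have hm : MeasurableSet {x : ℝ × Ω | 0 ≤ Φ x.1.toNNReal x.2} :=
      measurableSet_le measurable_const (hΦ.comp hT)
    exact (Measure.ae_ae_comm (p := fun (t : ℝ) ω ↦ 0 ≤ Φ t.toNNReal ω) hm).1
      (ae_of_all _ fun t ↦ hΦ0 _)
  rw [← lintegral_const_mul _ hmE]
  refine extIntegral_eq_sub (measurable_setLIntegral_time hτ hF).aemeasurable
    (hmE.const_mul _).aemeasurable ?_ ?_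
  · refine ne_top_of_le_ne_top (b := ENNReal.ofReal c⁻¹) ENNReal.ofReal_ne_top ?_
    calc _ ≤ ∫⁻ _, ENNReal.ofReal c⁻¹ * 1 ∂P₀ := lintegral_mono fun ω ↦ by gcongr; exact hle ω
      _ = _ := by simp
  · filter_upwards [hnn] with ω hω
    have hd : Measurable fun t : ℝ ↦ ENNReal.ofReal (lam * Real.exp (-lam * t)) := by fun_prop
    rw [← lintegral_const_mul _ hd]
    refine extIntegral_eq_sub (hF.comp measurable_prodMk_right).aemeasurable
      (hd.const_mul _).aemeasurable ?_ ?_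
    · rw [lintegral_const_mul _ hd]
      exact ENNReal.mul_ne_top ENNReal.ofReal_ne_top
        (ne_top_of_le_ne_top ENNReal.one_ne_top (hle ω))
    · filter_upwards [ae_restrict_of_ae hω] with t ht
      rw [← ENNReal.ofReal_mul (by positivity), ← ENNReal.ofReal_mul (by positivity),
        EReal.coe_ennreal_ofReal, EReal.coe_ennreal_ofReal,
        max_eq_left (mul_nonneg (by positivity) ht), max_eq_left (by positivity),
        ← EReal.coe_sub, EReal.coe_eq_coe_iff]
      field_simp

/-- Substitute `p = q - q I`. The hypothesis forces `p` and `I` to be finite, so only `V` can be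
infinite, and then both sides are `⊤`. -/
lemma bayes_ereal_arith {c q : ℝ} (hc : 0 < c) (hq : 0 < q) {p V I : ℝ≥0∞}
    (hp : p + ENNReal.ofReal q * I = ENNReal.ofReal q) :
    ((p + ENNReal.ofReal c * (ENNReal.ofReal q * V) : ℝ≥0∞) : EReal) =
      (q : EReal) + ((c * q : ℝ) : EReal) *
        ((V : EReal) - ((ENNReal.ofReal c⁻¹ * I : ℝ≥0∞) : EReal)) := by
  have hI : I ≠ ∞ := by
    rintro rfl
    rw [ENNReal.mul_top (by simpa using hq), add_top] at hp
    exact ENNReal.ofReal_ne_top hp.symm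
  have hp' : p ≠ ∞ := ne_top_of_le_ne_top ENNReal.ofReal_ne_top (le_self_add.trans_eq hp)
  lift I to ℝ≥0 using hI
  lift p to ℝ≥0 using hp'
  lift c to ℝ≥0 using hc.le
  lift q to ℝ≥0 using hq.le
  rw [← NNReal.coe_inv]
  simp only [ENNReal.ofReal_coe_nnreal] at hp ⊢
  have hp2 : (p : ℝ) + q * I = q := by exact_mod_cast hp
  have hc0 : (c : ℝ) ≠ 0 := hc.ne'
  induction V with
  | top =>
    rw [ENNReal.mul_top (by simpa using hq.ne'), ENNReal.mul_top (by simpa using hc.ne'), add_top,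
      ← ENNReal.coe_mul]
    change (⊤ : EReal) = _ + _ * (⊤ - (((c⁻¹ * I : ℝ≥0) : ℝ) : EReal))
    rw [EReal.top_sub_coe, EReal.coe_mul_top_of_pos (by positivity), EReal.coe_add_top]
  | coe V =>
    rw [← ENNReal.coe_mul, ← ENNReal.coe_mul, ← ENNReal.coe_add, ← ENNReal.coe_mul]
    change (((p + c * (q * V) : ℝ≥0) : ℝ) : EReal) =
      ((q : ℝ) : EReal) + _ * (((V : ℝ) : EReal) - (((c⁻¹ * I : ℝ≥0) : ℝ) : EReal))
    rw [← EReal.coe_sub, ← EReal.coe_mul, ← EReal.coe_add, EReal.coe_eq_coe_iff]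
    push_cast
    field_simp
    linarith

end BayesRisk

end PoissonDisorder

/-! ### The Bayes risk formula. -/

theorem lemma3p1 {Ω : Type*} [mΩ : MeasurableSpace Ω]
    (P₀ P : Measure Ω) [IsProbabilityMeasure P₀] [IsProbabilityMeasure P]
    (μ : ℝ≥0) (hμ : 0 < μ) (lam c π : ℝ) (hlam : 0 < lam) (hc : 0 < c) (hπ : π ∈ Ico (0 : ℝ) 1)
    (N : ℝ≥0 → Ω → ℕ) (hN : PoissonDisorder.IsPoissonProcess P₀ μ N)
    (θ : Ω → ℝ≥0) (Λ : Ω → ℝ) (hθ : Measurable θ) (hΛ : Measurable Λ)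
    (hΛ_nonneg : ∀ᵐ ω ∂P₀, 0 ≤ Λ ω)
    (hΛ_moments : ∀ k : ℕ, Integrable (fun v : ℝ ↦ (v - μ) ^ k) (P₀.map Λ))
    (hθ_zero : P₀ {ω | θ ω = 0} = ENNReal.ofReal π)
    (hθ_tail : ∀ t : ℝ≥0,
      P₀ {ω | t < θ ω} = ENNReal.ofReal ((1 - π) * Real.exp (-lam * t)))
    (h_indep : IndepFun θ Λ P₀)
    (h_indep_N : IndepFun (fun ω ↦ (θ ω, Λ ω)) (fun ω t ↦ N t ω) P₀)
    (𝓝 : Set (Set Ω)) (h𝓝 : ∀ A ∈ 𝓝, MeasurableSet A) (h𝓝_null : ∀ A ∈ 𝓝, P₀ A = 0)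
    (𝓕 : Filtration ℝ≥0 mΩ) (h𝓕 : 𝓕 = PoissonDisorder.obsFiltration N hN.measurable 𝓝 h𝓝)
    (hP : ∀ (t : ℝ≥0) (A : Set Ω),
      MeasurableSet[PoissonDisorder.enlarged 𝓕 θ Λ t] A →
        P A = ∫⁻ ω in A, PoissonDisorder.density N μ θ Λ t ω ∂P₀)
    (Φ : ℝ≥0 → Ω → ℝ) (hΦ : PoissonDisorder.IsOddsRatioProcess P 𝓕 μ θ Λ 0 Φ)
    (τ : Ω → ℝ≥0∞) (hτ : IsStoppingTime 𝓕 τ) :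
    (PoissonDisorder.bayesRisk P θ c τ : EReal) =
      ((1 - π : ℝ) : EReal) + ((c * (1 - π) : ℝ) : EReal) *
        PoissonDisorder.extIntegral P₀ (fun ω ↦
          PoissonDisorder.extIntegral (volume.restrict {t : ℝ | 0 ≤ t ∧ ENNReal.ofReal t < τ ω})
            (fun t ↦ ((Real.exp (-lam * t) * (Φ t.toNNReal ω - lam / c) : ℝ) : EReal))) := by
  have hq : 0 < 1 - π := sub_pos.2 hπ.2
  have hind : Indep (⨆ t, 𝓕 t) (MeasurableSpace.comap θ inferInstance) P₀ := by
    rw [h𝓕]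
    exact PoissonDisorder.indep_obsFiltration hN.measurable
      (h_indep_N.comp measurable_fst measurable_id) h𝓝 h𝓝_null
  have heq : ∀ (t : ℝ≥0) (A : Set Ω), MeasurableSet[𝓕 t] A →
      P (A ∩ {ω | t < θ ω}) = P₀ (A ∩ {ω | t < θ ω}) := fun t A hA ↦
    PoissonDisorder.measure_inter_lt_eq P₀ P hμ hθ 𝓕 hP hA
  have hk : ∀ (t : ℝ≥0) (A : Set Ω), MeasurableSet[𝓕 t] A →
      P (A ∩ {ω | t < θ ω}) = ENNReal.ofReal ((1 - π) * Real.exp (-lam * t)) * P₀ A := by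
    intro t A hA
    rw [heq t A hA, ← hθ_tail t, mul_comm]
    exact (Indep_iff _ _ _).1 hind A _ (le_iSup (fun t ↦ (𝓕 t : MeasurableSpace Ω)) t A hA)
      ⟨Ioi t, measurableSet_Ioi, rfl⟩
  have hnull : ∀ (t : ℝ≥0) (A : Set Ω), MeasurableSet[𝓕 t] A → P₀ A = 0 → P A = 0 := by
    intro t A hA h0
    rw [hP t A ((le_sup_left.trans le_sup_left : 𝓕 t ≤ PoissonDisorder.enlarged 𝓕 θ Λ t) A hA)]
    exact setLIntegral_measure_zero _ _ h0
  -- The factor `k` is the tail `(1 - π) e^{-λt}`, positive because `π < 1`.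
  have hΦ' := fun t ↦ hΦ.nonneg_and_measure_inter_le hθ
    (ENNReal.ofReal_pos.2 (by positivity)).ne' (hk t) (hnull t)
  have hτ' := PoissonDisorder.measurable_of_isStoppingTime hτ
  have hτm : Measurable τ := hτ'.mono (iSup_le 𝓕.le) le_rfl
  have hindτ : IndepFun τ θ P₀ := (IndepFun_iff_Indep _ _ _).2 (indep_of_indep_of_le_left hind hτ'.comap_le)
  have hsub := PoissonDisorder.lintegral_sub_eq (P₀ := P₀) (P := P) (by fun_prop) hθ hτ hτm
    hΦ.measurable fun t ↦ (hΦ' t).2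
  have hV : ∫⁻ ω, (τ ω - θ ω) ∂P = ENNReal.ofReal (1 - π) *
      ∫⁻ ω, (∫⁻ t in {t : ℝ | 0 ≤ t ∧ ENNReal.ofReal t < τ ω},
        ENNReal.ofReal (Real.exp (-lam * t)) * ENNReal.ofReal (Φ t.toNNReal ω)) ∂P₀ := by
    rw [hsub, ← lintegral_const_mul' _ _ ENNReal.ofReal_ne_top]
    refine lintegral_congr fun ω ↦ ?_
    rw [← lintegral_const_mul' _ _ ENNReal.ofReal_ne_top]
    refine setLIntegral_congr_fun (PoissonDisorder.measurableSet_time _) fun t ht ↦ ?_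
    rw [Real.coe_toNNReal t ht.1, ENNReal.ofReal_mul hq.le, mul_assoc]
  rw [PoissonDisorder.bayesRisk, PoissonDisorder.measure_stoppingTime_lt_eq hθ hτ heq, hV,
    PoissonDisorder.extIntegral_stopped_eq hlam hc hτm hΦ.measurable fun t ↦ (hΦ' t).1]
  exact PoissonDisorder.bayes_ereal_arith hc hq
    (PoissonDisorder.measure_lt_add_lintegral_exp hlam hq.le hθ hτm hindτ hθ_tail)
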